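/- Let $K$ be a number of descriptions, let $X$ be a real random variable with finite variance (arbitrarily distributed otherwise), and let $Z$ be a random variable with values in an arbitrary measurable space, arbitrarily jointly distributed with $X$. Let $N_0,\dots,N_{K-1}$ be i.i.d. standard Gaussian $\mathcal N(0,1)$ random variables such that $(X,Z)$ is independent of $(N_0,\dots,N_{K-1})$, and for $\gamma>0$ put $Y_i=\sqrt{\gamma}\,X+N_i$, $i=0,\dots,K-1$. Let $$I(X;Y_0,\dots,Y_{K-1}\mid Z)=\mathbb E_Z\big[D\big(P_{X,Y_0,\dots,Y_{K-1}|Z}\,\big\|\,P_{X|Z}\times P_{Y_0,\dots,Y_{K-1}|Z}\big)\big]$$ denote the conditional mutual information in bits (the relative entropy $D$ is taken with $\log_2$), and let $\mathrm{var}(X|Z)=\mathbb E_Z[\mathrm{var}(X|Z=z)]=\mathbb E\big[(X-\mathbb E[X|Z])^2\big]$. Then $$\lim_{\gamma\downarrow 0}\frac1\gamma\, I(X;Y_0,\dots,Y_{K-1}\mid Z)=\frac{K\log_2 e}{2}\,\mathrm{var}(X|Z).$$ -/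

import Mathlib

open MeasureTheory ProbabilityTheory InformationTheory Filter Topology
open scoped ENNReal

/-- Conditional mutual information `I(U; V | Z)` in bits:
`E_Z [ D( P_{U,V|Z} ‖ P_{U|Z} × P_{V|Z} ) ]`, where `P_{·|Z}` are regular conditional distributions.
Mathlib's `klDiv` uses the natural logarithm, hence the division by `log 2`. -/
noncomputable def condMutualInfo {Ω A B C : Type*} [MeasurableSpace Ω]
    [MeasurableSpace A] [StandardBorelSpace A] [Nonempty A]
    [MeasurableSpace B] [StandardBorelSpace B] [Nonempty B] [MeasurableSpace C]
    (μ : Measure Ω) [IsFiniteMeasure μ] (U : Ω → A) (V : Ω → B) (Z : Ω → C) : ℝ≥0∞ :=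
  (∫⁻ z, klDiv (condDistrib (fun ω => (U ω, V ω)) Z μ z)
      ((condDistrib U Z μ z).prod (condDistrib V Z μ z)) ∂(μ.map Z)) / ENNReal.ofReal (Real.log 2)

/-- The averaged conditional variance `var(X|Z) = E_Z [ var(X | Z = z) ]`, a real number. -/
noncomputable def avgCondVar {Ω C : Type*} [MeasurableSpace Ω] [MeasurableSpace C]
    (μ : Measure Ω) (X : Ω → ℝ) (Z : Ω → C) : ℝ :=
  ∫ ω, condVar (MeasurableSpace.comap Z inferInstance) X μ ω ∂μ

/-!
Let `N` be a standard Gaussian vector. The output law of the channel `x ↦ x • h + N` has a density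
with respect to the law of `N` which is the mean of the densities `gaussianShiftDensity (x • h)`
over the input law `ν`. Among all reference densities the mean minimizes the average
relative entropy of these densities, so replacing it by the density for the mean input bounds the
mutual information by `‖h‖² Var[ν] / 2`, the average relative entropy of two shifted Gaussians.
For `h = ε • a` this bound is asymptotically sharp: Fatou's lemma reduces the lower bound to a
pointwise second-order expansion in `ε`, which comes from `klFun t ∼ (t - 1) ^ 2 / 2` at `t = 1`
and differentiation of the mixture density under the integral.

Conditionally on `Z = z` the pair `(X, Y)` is such a channel with input law `P_{X|Z=z}`, and the
same upper bound dominates the passage to the limit under the expectation over `Z`.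
-/

lemma tendsto_klFun_div_sub_one_sq :
    Tendsto (fun t => klFun t / (t - 1) ^ 2) (𝓝[≠] 1) (𝓝 (1 / 2)) := by
  have hlog : Tendsto (fun t => Real.log t / (2 * (t - 1))) (𝓝[≠] 1) (𝓝 (1 / 2)) := by
    have hslope := (hasDerivAt_iff_tendsto_slope.1 (Real.hasDerivAt_log one_ne_zero)).const_mul
      (1 / 2 : ℝ)
    simp only [inv_one, mul_one] at hslope
    refine hslope.congr fun t => ?_
    rw [slope_def_field, Real.log_one, sub_zero, div_mul_div_comm, one_mul]
  have hsq : Continuous fun t : ℝ => (t - 1) ^ 2 := by fun_prop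
  refine HasDerivAt.lhopital_zero_nhdsNE (f' := Real.log) (g' := fun t => 2 * (t - 1))
    ?_ ?_ ?_ ?_ ?_ hlog
  · filter_upwards [nhdsWithin_le_nhds (eventually_ne_nhds one_ne_zero)] with t ht
    exact hasDerivAt_klFun ht
  · exact Eventually.of_forall fun t =>
      (((hasDerivAt_id t).sub_const 1).pow 2).congr_deriv (by simp)
  · filter_upwards [self_mem_nhdsWithin] with t ht
    exact mul_ne_zero two_ne_zero (sub_ne_zero.2 ht)
  · exact (continuous_klFun.tendsto' 1 0 klFun_one).mono_left nhdsWithin_le_nhds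
  · exact (hsq.tendsto' 1 0 (by simp)).mono_left nhdsWithin_le_nhds

lemma tendsto_klFun_comp_div_sq {f : ℝ → ℝ} {d : ℝ} (hf : HasDerivAt f d 0) (hf0 : f 0 = 1) :
    Tendsto (fun ε => klFun (f ε) / ε ^ 2) (𝓝[≠] 0) (𝓝 (d ^ 2 / 2)) := by
  -- Extending the quotient continuously to `1` spares the case distinction `f ε = 1`.
  set G : ℝ → ℝ := Function.update (fun t => klFun t / (t - 1) ^ 2) 1 (1 / 2) with hG
  have klFun_eq (t : ℝ) : klFun t = G t * (t - 1) ^ 2 := by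
    rcases eq_or_ne t 1 with rfl | ht
    · simp [klFun_one]
    · rw [hG, Function.update_of_ne ht, div_mul_cancel₀]
      exact pow_ne_zero _ (sub_ne_zero.2 ht)
  have hGf : Tendsto (fun ε => G (f ε)) (𝓝[≠] 0) (𝓝 (1 / 2)) := by
    have hG1 : Tendsto G (𝓝 1) (𝓝 (1 / 2)) := by
      simpa [hG] using (continuousAt_update_same.2 tendsto_klFun_div_sub_one_sq).tendsto
    exact hG1.comp ((hf0 ▸ hf.continuousAt.tendsto).mono_left nhdsWithin_le_nhds)
  have hslope : Tendsto (fun ε => ((f ε - 1) / ε) ^ 2) (𝓝[≠] 0) (𝓝 (d ^ 2)) := by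
    refine ((hasDerivAt_iff_tendsto_slope.1 hf).pow 2).congr fun ε => ?_
    rw [slope_def_field, hf0, sub_zero]
  rw [show d ^ 2 / 2 = 1 / 2 * d ^ 2 by ring]
  refine (hGf.mul hslope).congr fun ε => ?_
  rw [klFun_eq, div_pow, mul_div_assoc]

/-- The perspective `r * klFun (p / r)` of `klFun`: the integrand of the relative entropy
between two measures with densities `p` and `r` with respect to a common reference measure. -/
noncomputable def klPerspective (p r : ℝ) : ℝ :=
  r * klFun (p / r)

lemma klPerspective_nonneg {p r : ℝ} (hp : 0 ≤ p) (hr : 0 ≤ r) : 0 ≤ klPerspective p r :=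
  mul_nonneg hr (klFun_nonneg (div_nonneg hp hr))

lemma klPerspective_eq_klFun_sub {p r : ℝ} (hp : 0 < p) (hr : 0 < r) :
    klPerspective p r = klFun p - p * Real.log r + (r - 1) := by
  rw [klPerspective, klFun_apply, klFun_apply, Real.log_div hp.ne' hr.ne']
  field_simp
  ring

@[fun_prop]
lemma measurable_klPerspective {α : Type*} [MeasurableSpace α] {p r : α → ℝ} (hp : Measurable p)
    (hr : Measurable r) : Measurable fun a => klPerspective (p a) (r a) :=
  hr.mul (measurable_klFun.comp (hp.div hr))

lemma tendsto_klPerspective_div_sq {f g : ℝ → ℝ} {f' g' : ℝ} (hf : HasDerivAt f f' 0)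
    (hg : HasDerivAt g g' 0) (hf0 : f 0 = 1) (hg0 : g 0 = 1) :
    Tendsto (fun ε => klPerspective (f ε) (g ε) / ε ^ 2) (𝓝[≠] 0) (𝓝 ((f' - g') ^ 2 / 2)) := by
  have hquot : HasDerivAt (fun ε => f ε / g ε) (f' - g') 0 :=
    (hf.fun_div hg (by simp [hg0])).congr_deriv (by simp [hf0, hg0])
  have hg1 : Tendsto g (𝓝[≠] 0) (𝓝 1) :=
    (hg0 ▸ hg.continuousAt.tendsto).mono_left nhdsWithin_le_nhds
  rw [← one_mul ((f' - g') ^ 2 / 2)]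
  refine (hg1.mul (tendsto_klFun_comp_div_sq hquot (by simp [hf0, hg0]))).congr fun ε => ?_
  rw [klPerspective, mul_div_assoc]

section MeanMinimizes

variable {α : Type*} [MeasurableSpace α] {ν : Measure α} [IsProbabilityMeasure ν] {f : α → ℝ}

lemma integral_pos_of_forall_pos (hf0 : ∀ x, 0 < f x) (hf : Integrable f ν) :
    0 < ∫ x, f x ∂ν := by
  have hsupp : Function.support f = Set.univ :=
    Set.eq_univ_of_forall fun x => (hf0 x).ne'
  simp [integral_pos_iff_support_of_nonneg (fun x => (hf0 x).le) hf, hsupp]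

lemma integrable_klPerspective_const (hf0 : ∀ x, 0 < f x) (hf : Integrable f ν)
    (hklf : Integrable (fun x => klFun (f x)) ν) {r : ℝ} (hr : 0 < r) :
    Integrable (fun x => klPerspective (f x) r) ν :=
  ((hklf.sub (hf.mul_const _)).add (integrable_const _)).congr
    (ae_of_all _ fun x => (klPerspective_eq_klFun_sub (hf0 x) hr).symm)

lemma integral_klPerspective_const (hf0 : ∀ x, 0 < f x) (hf : Integrable f ν)
    (hklf : Integrable (fun x => klFun (f x)) ν) {r : ℝ} (hr : 0 < r) :
    ∫ x, klPerspective (f x) r ∂ν =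
      ∫ x, klFun (f x) ∂ν - (∫ x, f x ∂ν) * Real.log r + (r - 1) := by
  have hdiff : Integrable (fun x => klFun (f x) - f x * Real.log r) ν := hklf.sub (hf.mul_const _)
  simp only [klPerspective_eq_klFun_sub (hf0 _) hr]
  rw [integral_add hdiff (integrable_const _), integral_sub hklf (hf.mul_const _),
    integral_mul_const, integral_const, probReal_univ, one_smul]

lemma integral_klPerspective_integral_le (hf0 : ∀ x, 0 < f x) (hf : Integrable f ν)
    (hklf : Integrable (fun x => klFun (f x)) ν) {q : ℝ} (hq : 0 < q) :
    ∫ x, klPerspective (f x) (∫ t, f t ∂ν) ∂ν ≤ ∫ x, klPerspective (f x) q ∂ν := by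
  have hmean : 0 < ∫ t, f t ∂ν := integral_pos_of_forall_pos hf0 hf
  rw [integral_klPerspective_const hf0 hf hklf hmean, integral_klPerspective_const hf0 hf hklf hq]
  -- The difference of the two sides is `klPerspective (∫ f) q`.
  have hgap := klPerspective_nonneg hmean.le hq.le
  rw [klPerspective_eq_klFun_sub hmean hq, klFun_apply] at hgap
  linarith

end MeanMinimizes

section WithDensity

lemma klDiv_withDensity_ofReal {α : Type*} [MeasurableSpace α] (ρ : Measure α)
    {p r : α → ℝ} (hp : Measurable p) (hr : Measurable r) (hp0 : ∀ a, 0 ≤ p a) (hr0 : ∀ a, 0 < r a)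
    [IsFiniteMeasure (ρ.withDensity fun a => ENNReal.ofReal (p a))]
    [IsFiniteMeasure (ρ.withDensity fun a => ENNReal.ofReal (r a))] :
    klDiv (ρ.withDensity fun a => ENNReal.ofReal (p a))
      (ρ.withDensity fun a => ENNReal.ofReal (r a)) =
      ∫⁻ a, ENNReal.ofReal (klPerspective (p a) (r a)) ∂ρ := by
  set P := ρ.withDensity fun a => ENNReal.ofReal (p a) with hP
  set Q := ρ.withDensity fun a => ENNReal.ofReal (r a) with hQ
  have hPQ : P = Q.withDensity fun a => ENNReal.ofReal (p a / r a) := by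
    rw [hP, hQ, ← withDensity_mul _ (by fun_prop) (by fun_prop)]
    congr with a
    rw [Pi.mul_apply, ← ENNReal.ofReal_mul (hr0 a).le, mul_div_cancel₀ _ (hr0 a).ne']
  have hrnDeriv : P.rnDeriv Q =ᵐ[Q] fun a => ENNReal.ofReal (p a / r a) :=
    hPQ ▸ Measure.rnDeriv_withDensity Q (by fun_prop)
  calc klDiv P Q = ∫⁻ a, ENNReal.ofReal (klFun (P.rnDeriv Q a).toReal) ∂Q :=
        klDiv_eq_lintegral_klFun_of_ac (hPQ ▸ withDensity_absolutelyContinuous _ _)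
    _ = ∫⁻ a, ENNReal.ofReal (klFun (p a / r a)) ∂Q := by
        refine lintegral_congr_ae ?_
        filter_upwards [hrnDeriv] with a ha
        rw [ha, ENNReal.toReal_ofReal (div_nonneg (hp0 a) (hr0 a).le)]
    _ = ∫⁻ a, ENNReal.ofReal (klPerspective (p a) (r a)) ∂ρ := by
        have hklFun : Measurable fun a => ENNReal.ofReal (klFun (p a / r a)) :=
          (measurable_klFun.comp (hp.div hr)).ennreal_ofReal
        rw [hQ, lintegral_withDensity_eq_lintegral_mul _ (by fun_prop) hklFun]
        refine lintegral_congr fun a => ?_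
        rw [Pi.mul_apply, ← ENNReal.ofReal_mul (hr0 a).le, klPerspective]

lemma pi_withDensity {ι : Type*} [Fintype ι] {α : ι → Type*} [∀ i, MeasurableSpace (α i)]
    (ρ : ∀ i, Measure (α i)) [∀ i, IsProbabilityMeasure (ρ i)] {f : ∀ i, α i → ℝ≥0∞}
    (hf : ∀ i, Measurable (f i)) [∀ i, SigmaFinite ((ρ i).withDensity (f i))] :
    Measure.pi (fun i => (ρ i).withDensity (f i)) =
      (Measure.pi ρ).withDensity fun y => ∏ i, f i (y i) := by
  refine Measure.pi_eq fun s hs => ?_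
  have indicator_prod (y : ∀ i, α i) : (Set.univ.pi s).indicator (fun y => ∏ i, f i (y i)) y =
      ∏ i, (s i).indicator (f i) (y i) := by
    by_cases hy : ∀ i, y i ∈ s i
    · simp [Set.mem_univ_pi.2 hy, hy]
    · obtain ⟨i, hi⟩ := not_forall.1 hy
      rw [Set.indicator_of_notMem fun h => hi (Set.mem_univ_pi.1 h i),
        Finset.prod_eq_zero (Finset.mem_univ i) (Set.indicator_of_notMem hi _)]
  have hfs (i : ι) : Measurable ((s i).indicator (f i)) := (hf i).indicator (hs i)
  rw [withDensity_apply _ (MeasurableSet.univ_pi hs),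
    ← lintegral_indicator (MeasurableSet.univ_pi hs), lintegral_congr indicator_prod,
    lintegral_prod_eq_prod_lintegral_of_indepFun Finset.univ
      (fun i (y : ∀ i, α i) => (s i).indicator (f i) (y i))
      (iIndepFun_pi fun i => (hfs i).aemeasurable)
      (fun i => (hfs i).comp (measurable_pi_apply i))]
  refine Finset.prod_congr rfl fun i _ => ?_
  rw [(measurePreserving_eval ρ i).lintegral_comp (hfs i), withDensity_apply _ (hs i),
    lintegral_indicator (hs i)]

variable {α β γ : Type*} [MeasurableSpace α] [MeasurableSpace β] [MeasurableSpace γ]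

lemma map_prod_eq_withDensity (ν : Measure α) (ρ : Measure β) [SFinite ρ] (τ : Measure γ)
    [SFinite τ] {T : α → β → γ} (hT : Measurable fun q : α × β => T q.1 q.2)
    {f : α → γ → ℝ≥0∞} (hf : Measurable fun q : α × γ => f q.1 q.2)
    (hTf : ∀ x, ρ.map (T x) = τ.withDensity (f x)) :
    (ν.prod ρ).map (fun q => (q.1, T q.1 q.2)) =
      (ν.prod τ).withDensity fun q => f q.1 q.2 := by
  refine Measure.ext_of_lintegral _ fun g hg => ?_
  rw [lintegral_map hg (by fun_prop), lintegral_prod _ (by fun_prop),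
    lintegral_withDensity_eq_lintegral_mul _ hf hg, lintegral_prod _ (by fun_prop)]
  refine lintegral_congr fun x => ?_
  have hgx : Measurable fun y => g (x, y) := by fun_prop
  have hTx : Measurable (T x) := hT.comp measurable_prodMk_left
  have hfx : Measurable (f x) := hf.comp measurable_prodMk_left
  rw [← lintegral_map hgx hTx, hTf x, lintegral_withDensity_eq_lintegral_mul _ hfx hgx]
  rfl

lemma map_snd_withDensity_prod (ν : Measure α) [SFinite ν] (τ : Measure γ) [SFinite τ]
    {f : α × γ → ℝ≥0∞} (hf : Measurable f) :
    ((ν.prod τ).withDensity f).map Prod.snd = τ.withDensity fun y => ∫⁻ x, f (x, y) ∂ν := by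
  ext s hs
  rw [Measure.map_apply measurable_snd hs, withDensity_apply _ (measurable_snd hs),
    withDensity_apply _ hs, ← Set.univ_prod, ← Measure.prod_restrict, Measure.restrict_univ,
    lintegral_prod_symm _ hf.aemeasurable]

end WithDensity

section GaussianChannel

variable {ι : Type*} [Fintype ι]

/-- The standard Gaussian measure on `ι → ℝ`. -/
noncomputable abbrev stdGaussianPi (ι : Type*) [Fintype ι] : Measure (ι → ℝ) :=
  Measure.pi fun _ => gaussianReal 0 1

/-- The density at `y` of the standard Gaussian measure shifted by `h`, relative to the unshifted
one. -/
noncomputable def gaussianShiftDensity (h y : ι → ℝ) : ℝ :=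
  Real.exp (∑ i, (h i * y i - h i ^ 2 / 2))

lemma gaussianShiftDensity_pos (h y : ι → ℝ) : 0 < gaussianShiftDensity h y :=
  Real.exp_pos _

lemma gaussianShiftDensity_le (h y : ι → ℝ) :
    gaussianShiftDensity h y ≤ Real.exp (∑ i, y i ^ 2 / 2) :=
  Real.exp_le_exp.2 <| Finset.sum_le_sum fun i _ => by nlinarith [sq_nonneg (y i - h i)]

lemma gaussianShiftDensity_smul (c : ℝ) (h y : ι → ℝ) :
    gaussianShiftDensity (c • h) y =
      Real.exp (c * ∑ i, h i * y i - c ^ 2 * (∑ i, h i ^ 2) / 2) := by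
  rw [gaussianShiftDensity, Finset.sum_sub_distrib, Finset.mul_sum, Finset.mul_sum,
    Finset.sum_div]
  simp only [Pi.smul_apply, smul_eq_mul, mul_pow, mul_assoc]

lemma log_gaussianShiftDensity (h y : ι → ℝ) :
    Real.log (gaussianShiftDensity h y) = ∑ i, (h i * y i - h i ^ 2 / 2) :=
  Real.log_exp _

@[fun_prop]
lemma continuous_gaussianShiftDensity {α : Type*} [TopologicalSpace α] {f g : α → ι → ℝ}
    (hf : Continuous f) (hg : Continuous g) :
    Continuous fun a => gaussianShiftDensity (f a) (g a) := by
  unfold gaussianShiftDensity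
  fun_prop

@[fun_prop]
lemma measurable_gaussianShiftDensity {α : Type*} [MeasurableSpace α] {f g : α → ι → ℝ}
    (hf : Measurable f) (hg : Measurable g) :
    Measurable fun a => gaussianShiftDensity (f a) (g a) := by
  unfold gaussianShiftDensity
  fun_prop

lemma gaussianReal_map_const_add_eq_withDensity (c : ℝ) :
    (gaussianReal 0 1).map (c + ·) =
      (gaussianReal 0 1).withDensity fun t => ENNReal.ofReal (Real.exp (c * t - c ^ 2 / 2)) := by
  rw [gaussianReal_map_const_add, gaussianReal_of_var_ne_zero _ one_ne_zero,
    gaussianReal_of_var_ne_zero _ one_ne_zero, ← withDensity_mul _ (by fun_prop) (by fun_prop)]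
  congr with t
  rw [Pi.mul_apply, gaussianPDF, gaussianPDF, ← ENNReal.ofReal_mul (gaussianPDFReal_nonneg _ _ _),
    gaussianPDFReal, gaussianPDFReal, mul_assoc (_⁻¹), ← Real.exp_add]
  congr 3
  simp only [NNReal.coe_one]
  ring

lemma stdGaussianPi_map_const_add (h : ι → ℝ) :
    (stdGaussianPi ι).map (h + ·) =
      (stdGaussianPi ι).withDensity fun y => ENNReal.ofReal (gaussianShiftDensity h y) := by
  have hprob (i : ι) : IsProbabilityMeasure ((gaussianReal 0 1).map (h i + ·)) :=
    Measure.isProbabilityMeasure_map (by fun_prop)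
  have hpi : (stdGaussianPi ι).map (h + ·) = Measure.pi fun i => (gaussianReal 0 1).map (h i + ·) :=
    Measure.pi_map_pi (μ := fun _ => gaussianReal 0 1) (f := fun i t => h i + t)
      fun _ => by fun_prop
  simp only [gaussianReal_map_const_add_eq_withDensity] at hprob hpi
  rw [hpi, pi_withDensity _ fun _ => by fun_prop]
  congr with y
  rw [gaussianShiftDensity, Real.exp_sum,
    ENNReal.ofReal_prod_of_nonneg fun i _ => (Real.exp_pos _).le]

lemma integrable_gaussianShiftDensity_mul_iff (h : ι → ℝ) {g : (ι → ℝ) → ℝ} (hg : Measurable g) :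
    Integrable (fun y => gaussianShiftDensity h y * g y) (stdGaussianPi ι) ↔
      Integrable (fun y => g (h + y)) (stdGaussianPi ι) := by
  have hmap := integrable_map_measure (μ := stdGaussianPi ι) (f := (h + ·))
    hg.aestronglyMeasurable (by fun_prop)
  rw [stdGaussianPi_map_const_add, integrable_withDensity_iff_integrable_smul' (by fun_prop)
    (ae_of_all _ fun _ => ENNReal.ofReal_lt_top)] at hmap
  simpa only [ENNReal.toReal_ofReal (gaussianShiftDensity_pos h _).le, smul_eq_mul,
    Function.comp_def] using hmap

lemma integral_gaussianShiftDensity_mul (h : ι → ℝ) {g : (ι → ℝ) → ℝ} (hg : Measurable g) :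
    ∫ y, gaussianShiftDensity h y * g y ∂stdGaussianPi ι = ∫ y, g (h + y) ∂stdGaussianPi ι := by
  have hmap := integral_map (μ := stdGaussianPi ι) (φ := (h + ·)) (by fun_prop)
    hg.aestronglyMeasurable
  rw [stdGaussianPi_map_const_add, integral_withDensity_eq_integral_toReal_smul (by fun_prop)
    (ae_of_all _ fun _ => ENNReal.ofReal_lt_top)] at hmap
  simpa only [ENNReal.toReal_ofReal (gaussianShiftDensity_pos h _).le, smul_eq_mul] using hmap

lemma integrable_gaussianShiftDensity (h : ι → ℝ) :
    Integrable (gaussianShiftDensity h) (stdGaussianPi ι) := by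
  simpa using integrable_gaussianShiftDensity_mul_iff h (measurable_const (a := (1 : ℝ)))

lemma integral_gaussianShiftDensity (h : ι → ℝ) :
    ∫ y, gaussianShiftDensity h y ∂stdGaussianPi ι = 1 := by
  simpa using integral_gaussianShiftDensity_mul h (measurable_const (a := (1 : ℝ)))

lemma memLp_dotProduct_stdGaussianPi (h : ι → ℝ) :
    MemLp (fun y => ∑ i, h i * y i) 2 (stdGaussianPi ι) :=
  memLp_finsetSum _ fun i _ =>
    ((memLp_id_gaussianReal 2).comp_measurePreserving (measurePreserving_eval _ i)).const_mul (h i)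

lemma integrable_dotProduct_stdGaussianPi (h : ι → ℝ) :
    Integrable (fun y => ∑ i, h i * y i) (stdGaussianPi ι) :=
  (memLp_dotProduct_stdGaussianPi h).integrable one_le_two

lemma integral_dotProduct_stdGaussianPi (h : ι → ℝ) :
    ∫ y, ∑ i, h i * y i ∂stdGaussianPi ι = 0 := by
  have hid : Integrable id (gaussianReal 0 1) := (memLp_id_gaussianReal 1).integrable le_rfl
  have heval (i : ι) : ∫ y, y i ∂stdGaussianPi ι = 0 := by
    simpa only [id_eq, integral_id_gaussianReal] using
      integral_comp_eval (μ := fun _ : ι => gaussianReal 0 1) (i := i) hid.1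
  have hlin (i : ι) : Integrable (fun y : ι → ℝ => h i * y i) (stdGaussianPi ι) :=
    (integrable_comp_eval (μ := fun _ : ι => gaussianReal 0 1) (f := id) hid).const_mul _
  rw [integral_finsetSum _ fun i _ => hlin i]
  simp [integral_const_mul, heval]

lemma variance_dotProduct_stdGaussianPi (h : ι → ℝ) :
    Var[fun y => ∑ i, h i * y i; stdGaussianPi ι] = ∑ i, h i ^ 2 := by
  have hcoord (i : ι) : Var[fun t => h i * t; gaussianReal 0 1] = h i ^ 2 := by
    rw [variance_const_mul, variance_fun_id_gaussianReal, NNReal.coe_one, mul_one]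
  have hpi := variance_sum_pi (μ := fun _ : ι => gaussianReal 0 1)
    fun i => (memLp_id_gaussianReal 2).const_mul (h i)
  simpa only [id_eq, hcoord, Finset.sum_fn] using hpi

lemma lintegral_sq_dotProduct_stdGaussianPi (h : ι → ℝ) :
    ∫⁻ y, ENNReal.ofReal ((∑ i, h i * y i) ^ 2) ∂stdGaussianPi ι =
      ENNReal.ofReal (∑ i, h i ^ 2) := by
  rw [← variance_dotProduct_stdGaussianPi, ofReal_variance (memLp_dotProduct_stdGaussianPi h),
    evariance_eq_lintegral_ofReal, integral_dotProduct_stdGaussianPi]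
  simp only [sub_zero]

lemma klPerspective_gaussianShiftDensity (h k y : ι → ℝ) :
    klPerspective (gaussianShiftDensity h y) (gaussianShiftDensity k y) =
      gaussianShiftDensity h y * (∑ i, ((h i - k i) * y i - (h i ^ 2 - k i ^ 2) / 2)) +
        (gaussianShiftDensity k y - gaussianShiftDensity h y) := by
  have hsum : ∑ i, ((h i - k i) * y i - (h i ^ 2 - k i ^ 2) / 2) =
      ∑ i, (h i * y i - h i ^ 2 / 2) - ∑ i, (k i * y i - k i ^ 2 / 2) := by
    rw [← Finset.sum_sub_distrib]
    exact Finset.sum_congr rfl fun i _ => by ring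
  rw [klPerspective_eq_klFun_sub (gaussianShiftDensity_pos h y) (gaussianShiftDensity_pos k y),
    klFun_apply, log_gaussianShiftDensity, log_gaussianShiftDensity, hsum]
  ring

lemma lintegral_klPerspective_gaussianShiftDensity (h k : ι → ℝ) :
    ∫⁻ y, ENNReal.ofReal (klPerspective (gaussianShiftDensity h y) (gaussianShiftDensity k y))
      ∂stdGaussianPi ι = ENNReal.ofReal (∑ i, (h i - k i) ^ 2 / 2) := by
  set g : (ι → ℝ) → ℝ := fun y => ∑ i, ((h i - k i) * y i - (h i ^ 2 - k i ^ 2) / 2)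
  have g_shift (y : ι → ℝ) : g (h + y) = ∑ i, (h i - k i) * y i + ∑ i, (h i - k i) ^ 2 / 2 := by
    rw [← Finset.sum_add_distrib]
    exact Finset.sum_congr rfl fun i _ => by rw [Pi.add_apply]; ring
  have hg_meas : Measurable g := by fun_prop
  have hlin := integrable_dotProduct_stdGaussianPi fun i => h i - k i
  have hg_shift_integral :
      ∫ y, g (h + y) ∂stdGaussianPi ι = ∑ i, (h i - k i) ^ 2 / 2 := by
    simp only [g_shift]
    rw [integral_add hlin (integrable_const _), integral_dotProduct_stdGaussianPi, zero_add,
      integral_const, probReal_univ, one_smul]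
  have hg_int : Integrable (fun y => gaussianShiftDensity h y * g y) (stdGaussianPi ι) := by
    rw [integrable_gaussianShiftDensity_mul_iff h hg_meas]
    simp only [g_shift]
    exact hlin.add (integrable_const _)
  have hdiff_int : Integrable (fun y => gaussianShiftDensity k y - gaussianShiftDensity h y)
      (stdGaussianPi ι) :=
    (integrable_gaussianShiftDensity k).sub (integrable_gaussianShiftDensity h)
  have hkl (y : ι → ℝ) : klPerspective (gaussianShiftDensity h y) (gaussianShiftDensity k y) =
      gaussianShiftDensity h y * g y + (gaussianShiftDensity k y - gaussianShiftDensity h y) :=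
    klPerspective_gaussianShiftDensity h k y
  rw [← ofReal_integral_eq_lintegral_ofReal
    ((hg_int.add hdiff_int).congr (ae_of_all _ fun y => (hkl y).symm))
    (ae_of_all _ fun y => klPerspective_nonneg (gaussianShiftDensity_pos h y).le
      (gaussianShiftDensity_pos k y).le)]
  simp only [hkl]
  rw [integral_add hg_int hdiff_int, integral_sub (integrable_gaussianShiftDensity k)
    (integrable_gaussianShiftDensity h), integral_gaussianShiftDensity,
    integral_gaussianShiftDensity, integral_gaussianShiftDensity_mul h hg_meas,
    hg_shift_integral, sub_self, add_zero]

/-- The density at `y` of the output `x • h + N` of the Gaussian channel with gain vector `h`,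
standard Gaussian noise `N` and input `x ∼ ν`, relative to the law of the noise. -/
noncomputable def gaussianMixDensity (ν : Measure ℝ) (h y : ι → ℝ) : ℝ :=
  ∫ x, gaussianShiftDensity (x • h) y ∂ν

lemma integrable_gaussianShiftDensity_smul (ν : Measure ℝ) [IsFiniteMeasure ν] (h y : ι → ℝ) :
    Integrable (fun x : ℝ => gaussianShiftDensity (x • h) y) ν := by
  refine Integrable.of_bound (by fun_prop) (Real.exp (∑ i, y i ^ 2 / 2)) (ae_of_all _ fun x => ?_)
  rw [Real.norm_of_nonneg (gaussianShiftDensity_pos _ _).le]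
  exact gaussianShiftDensity_le _ _

lemma integrable_klFun_gaussianShiftDensity_smul (ν : Measure ℝ) [IsFiniteMeasure ν]
    (h y : ι → ℝ) : Integrable (fun x : ℝ => klFun (gaussianShiftDensity (x • h) y)) ν := by
  obtain ⟨M, hM⟩ := (isCompact_Icc (a := (0 : ℝ))
    (b := Real.exp (∑ i, y i ^ 2 / 2))).exists_bound_of_continuousOn continuous_klFun.continuousOn
  exact Integrable.of_bound (by fun_prop) M (ae_of_all _ fun x =>
    hM _ ⟨(gaussianShiftDensity_pos _ _).le, gaussianShiftDensity_le _ _⟩)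

lemma gaussianMixDensity_pos (ν : Measure ℝ) [IsProbabilityMeasure ν] (h y : ι → ℝ) :
    0 < gaussianMixDensity ν h y :=
  integral_pos_of_forall_pos (fun _ => gaussianShiftDensity_pos _ _)
    (integrable_gaussianShiftDensity_smul ν h y)

lemma gaussianShiftDensity_zero (y : ι → ℝ) : gaussianShiftDensity 0 y = 1 := by
  simp [gaussianShiftDensity]

lemma gaussianMixDensity_zero (ν : Measure ℝ) [IsProbabilityMeasure ν] (y : ι → ℝ) :
    gaussianMixDensity ν 0 y = 1 := by
  simp [gaussianMixDensity, gaussianShiftDensity_zero]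

lemma measurable_gaussianMixDensity_kernel {C : Type*} [MeasurableSpace C] (κ : Kernel C ℝ)
    [IsSFiniteKernel κ] (h : ι → ℝ) :
    Measurable fun q : C × (ι → ℝ) => gaussianMixDensity (κ q.1) h q.2 := by
  have hL : StronglyMeasurable fun q : (C × (ι → ℝ)) × ℝ =>
      gaussianShiftDensity (q.2 • h) q.1.2 := Measurable.stronglyMeasurable (by fun_prop)
  exact (hL.integral_kernel_prod_right' (κ := κ.prodMkRight (ι → ℝ))).measurable

@[fun_prop]
lemma measurable_gaussianMixDensity (ν : Measure ℝ) [SFinite ν] (h : ι → ℝ) :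
    Measurable (gaussianMixDensity ν h) :=
  (measurable_gaussianMixDensity_kernel (Kernel.const Unit ν) h).comp
    (measurable_prodMk_left (x := ()))

lemma hasDerivAt_gaussianShiftDensity_smul_smul (x : ℝ) (a y : ι → ℝ) (ε : ℝ) :
    HasDerivAt (fun ε : ℝ => gaussianShiftDensity (x • ε • a) y)
      (gaussianShiftDensity (x • ε • a) y * (x * ∑ i, a i * y i - ε * x ^ 2 * ∑ i, a i ^ 2)) ε := by
  simp only [smul_smul, gaussianShiftDensity_smul]
  have hlin : HasDerivAt (fun ε : ℝ => x * ε) x ε := by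
    simpa using (hasDerivAt_id ε).const_mul x
  refine ((hlin.mul_const _).sub (((hlin.pow 2).mul_const _).div_const 2)).exp.congr_deriv ?_
  simp only [Pi.sub_apply, Pi.pow_apply]
  push_cast
  ring

lemma hasDerivAt_gaussianMixDensity_smul {ν : Measure ℝ} [IsProbabilityMeasure ν]
    (hν : MemLp id 2 ν) (a y : ι → ℝ) :
    HasDerivAt (fun ε : ℝ => gaussianMixDensity ν (ε • a) y) ((∫ x, x ∂ν) * ∑ i, a i * y i) 0 := by
  set u := ∑ i, a i * y i
  set A := ∑ i, a i ^ 2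
  have hA0 : 0 ≤ A := Finset.sum_nonneg fun i _ => sq_nonneg _
  have hbound_int : Integrable
      (fun x : ℝ => Real.exp (∑ i, y i ^ 2 / 2) * (|x| * |u| + x ^ 2 * A)) ν :=
    (((hν.integrable one_le_two).abs.mul_const _).add (hν.integrable_sq.mul_const _)).const_mul _
  have hderiv_bound (x : ℝ) {ε : ℝ} (hε : ε ∈ Metric.ball (0 : ℝ) 1) :
      ‖gaussianShiftDensity (x • ε • a) y * (x * u - ε * x ^ 2 * A)‖ ≤
        Real.exp (∑ i, y i ^ 2 / 2) * (|x| * |u| + x ^ 2 * A) := by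
    have hε1 : |ε| ≤ 1 := by simpa using (Metric.mem_ball.1 hε).le
    rw [norm_mul, Real.norm_of_nonneg (gaussianShiftDensity_pos _ _).le]
    gcongr
    · exact gaussianShiftDensity_le _ _
    · refine (norm_sub_le _ _).trans ?_
      rw [Real.norm_eq_abs, Real.norm_eq_abs, abs_mul, abs_mul, abs_mul, abs_of_nonneg hA0,
        abs_of_nonneg (sq_nonneg x)]
      gcongr
      exact mul_le_of_le_one_left (sq_nonneg x) hε1
  have hF_meas (ε : ℝ) :
      AEStronglyMeasurable (fun x : ℝ => gaussianShiftDensity (x • ε • a) y) ν := by fun_prop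
  have hF'_meas : AEStronglyMeasurable
      (fun x : ℝ => gaussianShiftDensity (x • (0 : ℝ) • a) y * (x * u - 0 * x ^ 2 * A)) ν := by
    fun_prop
  have hderiv := (hasDerivAt_integral_of_dominated_loc_of_deriv_le (μ := ν) (x₀ := (0 : ℝ))
    (F := fun ε x => gaussianShiftDensity (x • ε • a) y)
    (F' := fun ε x => gaussianShiftDensity (x • ε • a) y * (x * u - ε * x ^ 2 * A))
    (Metric.ball_mem_nhds (0 : ℝ) one_pos) (Eventually.of_forall hF_meas)
    (integrable_gaussianShiftDensity_smul ν _ y) hF'_meas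
    (ae_of_all _ fun x _ => hderiv_bound x) hbound_int
    (ae_of_all _ fun x ε _ => hasDerivAt_gaussianShiftDensity_smul_smul x a y ε)).2
  refine hderiv.congr_deriv ?_
  simp [gaussianShiftDensity_zero, integral_mul_const, u]

/-- The mutual information, in nats, between the input `x ∼ ν` and the output `x • h + N` of the
Gaussian channel with gain vector `h` and standard Gaussian noise `N`. -/
noncomputable def gaussianChannelInfo (ν : Measure ℝ) (h : ι → ℝ) : ℝ≥0∞ :=
  ∫⁻ y, ∫⁻ x, ENNReal.ofReal
    (klPerspective (gaussianShiftDensity (x • h) y) (gaussianMixDensity ν h y)) ∂ν ∂stdGaussianPi ι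

lemma map_gaussianChannel_eq_withDensity (ν : Measure ℝ) (h : ι → ℝ) :
    (ν.prod (stdGaussianPi ι)).map (fun q => (q.1, q.1 • h + q.2)) =
      (ν.prod (stdGaussianPi ι)).withDensity fun q =>
        ENNReal.ofReal (gaussianShiftDensity (q.1 • h) q.2) :=
  map_prod_eq_withDensity ν (stdGaussianPi ι) (stdGaussianPi ι) (by fun_prop)
    (f := fun x y => ENNReal.ofReal (gaussianShiftDensity (x • h) y)) (by fun_prop)
    fun x => stdGaussianPi_map_const_add (x • h)

lemma map_gaussianChannel_output_eq_withDensity (ν : Measure ℝ) [IsFiniteMeasure ν] (h : ι → ℝ) :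
    (ν.prod (stdGaussianPi ι)).map (fun q => q.1 • h + q.2) =
      (stdGaussianPi ι).withDensity fun y => ENNReal.ofReal (gaussianMixDensity ν h y) := by
  have hsnd := Measure.map_map (μ := ν.prod (stdGaussianPi ι)) measurable_snd
    (f := fun q => (q.1, q.1 • h + q.2)) (by fun_prop)
  rw [map_gaussianChannel_eq_withDensity, map_snd_withDensity_prod ν _ (by fun_prop)] at hsnd
  refine hsnd.symm.trans ?_
  congr with y
  exact (ofReal_integral_eq_lintegral_ofReal (integrable_gaussianShiftDensity_smul ν h y)
    (ae_of_all _ fun _ => (gaussianShiftDensity_pos _ _).le)).symm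

lemma klDiv_gaussianChannel (ν : Measure ℝ) [IsProbabilityMeasure ν] (h : ι → ℝ) :
    klDiv ((ν.prod (stdGaussianPi ι)).map fun q => (q.1, q.1 • h + q.2))
      (ν.prod ((ν.prod (stdGaussianPi ι)).map fun q => q.1 • h + q.2)) =
      gaussianChannelInfo ν h := by
  have hprod : ν.prod ((ν.prod (stdGaussianPi ι)).map fun q => q.1 • h + q.2) =
      (ν.prod (stdGaussianPi ι)).withDensity fun q =>
        ENNReal.ofReal (gaussianMixDensity ν h q.2) := by
    rw [map_gaussianChannel_output_eq_withDensity, prod_withDensity_right (by fun_prop)]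
  have hjoint_fin : IsFiniteMeasure ((ν.prod (stdGaussianPi ι)).withDensity fun q =>
      ENNReal.ofReal (gaussianShiftDensity (q.1 • h) q.2)) := by
    rw [← map_gaussianChannel_eq_withDensity]; infer_instance
  have hprod_fin : IsFiniteMeasure ((ν.prod (stdGaussianPi ι)).withDensity fun q =>
      ENNReal.ofReal (gaussianMixDensity ν h q.2)) := by
    rw [← hprod]; infer_instance
  rw [hprod, map_gaussianChannel_eq_withDensity,
    klDiv_withDensity_ofReal _ (by fun_prop) (by fun_prop)
      (fun _ => (gaussianShiftDensity_pos _ _).le) (fun _ => gaussianMixDensity_pos ν h _),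
    lintegral_prod_symm _ (by fun_prop), gaussianChannelInfo]

lemma lintegral_klPerspective_gaussianMixDensity_le (ν : Measure ℝ) [IsProbabilityMeasure ν]
    (h y : ι → ℝ) {q : ℝ} (hq : 0 < q) :
    ∫⁻ x, ENNReal.ofReal
        (klPerspective (gaussianShiftDensity (x • h) y) (gaussianMixDensity ν h y)) ∂ν ≤
      ∫⁻ x, ENNReal.ofReal (klPerspective (gaussianShiftDensity (x • h) y) q) ∂ν := by
  have hpos (x : ℝ) : 0 < gaussianShiftDensity (x • h) y := gaussianShiftDensity_pos _ _
  have hint := integrable_gaussianShiftDensity_smul ν h y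
  have hkl := integrable_klFun_gaussianShiftDensity_smul ν h y
  have hmix := gaussianMixDensity_pos ν h y
  rw [← ofReal_integral_eq_lintegral_ofReal (integrable_klPerspective_const hpos hint hkl hmix)
      (ae_of_all _ fun x => klPerspective_nonneg (hpos x).le hmix.le),
    ← ofReal_integral_eq_lintegral_ofReal (integrable_klPerspective_const hpos hint hkl hq)
      (ae_of_all _ fun x => klPerspective_nonneg (hpos x).le hq.le)]
  exact ENNReal.ofReal_le_ofReal (integral_klPerspective_integral_le hpos hint hkl hq)

lemma gaussianChannelInfo_le (ν : Measure ℝ) [IsProbabilityMeasure ν] (h : ι → ℝ) :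
    gaussianChannelInfo ν h ≤ ENNReal.ofReal ((∑ i, h i ^ 2) / 2) * eVar[id; ν] := by
  set m := ∫ x, x ∂ν with hm
  calc gaussianChannelInfo ν h
      ≤ ∫⁻ y, ∫⁻ x, ENNReal.ofReal (klPerspective (gaussianShiftDensity (x • h) y)
          (gaussianShiftDensity (m • h) y)) ∂ν ∂stdGaussianPi ι :=
        lintegral_mono fun y => lintegral_klPerspective_gaussianMixDensity_le ν h y
          (gaussianShiftDensity_pos _ _)
    _ = ∫⁻ x, ∫⁻ y, ENNReal.ofReal (klPerspective (gaussianShiftDensity (x • h) y)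
          (gaussianShiftDensity (m • h) y)) ∂stdGaussianPi ι ∂ν :=
        lintegral_lintegral_swap (by unfold Function.uncurry; fun_prop)
    _ = ENNReal.ofReal ((∑ i, h i ^ 2) / 2) * eVar[id; ν] := by
        rw [evariance_eq_lintegral_ofReal, ← lintegral_const_mul _ (by fun_prop)]
        refine lintegral_congr fun x => ?_
        rw [lintegral_klPerspective_gaussianShiftDensity, ← ENNReal.ofReal_mul (by positivity)]
        congr 1
        simp only [Pi.smul_apply, smul_eq_mul, ← sub_mul, mul_pow, id_eq, ← hm]
        rw [← Finset.sum_div, ← Finset.mul_sum]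
        ring

lemma ofReal_inv_sq_mul_gaussianChannelInfo_smul_le (ν : Measure ℝ) [IsProbabilityMeasure ν]
    (a : ι → ℝ) {ε : ℝ} (hε : ε ≠ 0) :
    ENNReal.ofReal (1 / ε ^ 2) * gaussianChannelInfo ν (ε • a) ≤
      ENNReal.ofReal ((∑ i, a i ^ 2) / 2) * eVar[id; ν] := by
  refine (mul_le_mul_right (gaussianChannelInfo_le ν (ε • a)) _).trans_eq ?_
  rw [← mul_assoc, ← ENNReal.ofReal_mul (by positivity)]
  congr 2
  simp only [Pi.smul_apply, smul_eq_mul, mul_pow, ← Finset.mul_sum]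
  field_simp

lemma tendsto_klPerspective_gaussianMixDensity_div_sq {ν : Measure ℝ} [IsProbabilityMeasure ν]
    (hν : MemLp id 2 ν) (a y : ι → ℝ) (x : ℝ) :
    Tendsto (fun ε : ℝ => klPerspective (gaussianShiftDensity (x • ε • a) y)
        (gaussianMixDensity ν (ε • a) y) / ε ^ 2)
      (𝓝[≠] 0) (𝓝 ((∑ i, a i * y i) ^ 2 * ((x - ∫ t, t ∂ν) ^ 2 / 2))) := by
  have hshift : HasDerivAt (fun ε : ℝ => gaussianShiftDensity (x • ε • a) y)
      (x * ∑ i, a i * y i) 0 :=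
    (hasDerivAt_gaussianShiftDensity_smul_smul x a y 0).congr_deriv
      (by simp [gaussianShiftDensity_zero])
  convert tendsto_klPerspective_div_sq hshift (hasDerivAt_gaussianMixDensity_smul hν a y)
    (by simp [gaussianShiftDensity_zero]) (by simp [gaussianMixDensity_zero]) using 2
  ring

lemma ofReal_inv_sq_mul_gaussianChannelInfo_eq_lintegral_prod (ν : Measure ℝ) [SFinite ν]
    (h : ι → ℝ) (ε : ℝ) :
    ENNReal.ofReal (1 / ε ^ 2) * gaussianChannelInfo ν h =
      ∫⁻ q, ENNReal.ofReal (klPerspective (gaussianShiftDensity (q.2 • h) q.1)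
        (gaussianMixDensity ν h q.1) / ε ^ 2) ∂(stdGaussianPi ι).prod ν := by
  rw [gaussianChannelInfo,
    ← lintegral_prod (fun q : (ι → ℝ) × ℝ => ENNReal.ofReal (klPerspective
      (gaussianShiftDensity (q.2 • h) q.1) (gaussianMixDensity ν h q.1))) (by fun_prop),
    ← lintegral_const_mul _ (by fun_prop)]
  refine lintegral_congr fun q => ?_
  rw [← ENNReal.ofReal_mul (by positivity), one_div_mul_eq_div]

lemma lintegral_sq_dotProduct_mul_sq_sub_mean (ν : Measure ℝ) [SFinite ν] (a : ι → ℝ) :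
    ∫⁻ q, ENNReal.ofReal ((∑ i, a i * q.1 i) ^ 2 * ((q.2 - ∫ t, t ∂ν) ^ 2 / 2))
      ∂(stdGaussianPi ι).prod ν = ENNReal.ofReal ((∑ i, a i ^ 2) / 2) * eVar[id; ν] := by
  simp only [ENNReal.ofReal_mul (sq_nonneg _), div_eq_mul_inv]
  rw [lintegral_prod_mul (f := fun y : ι → ℝ => ENNReal.ofReal ((∑ i, a i * y i) ^ 2))
      (g := fun x => ENNReal.ofReal ((x - ∫ t, t ∂ν) ^ 2) * ENNReal.ofReal 2⁻¹)
      (Measurable.aemeasurable (by fun_prop)) (by fun_prop), lintegral_mul_const _ (by fun_prop),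
    lintegral_sq_dotProduct_stdGaussianPi, evariance_eq_lintegral_ofReal,
    ENNReal.ofReal_mul (by positivity), mul_assoc, mul_comm (ENNReal.ofReal 2⁻¹)]
  rfl

lemma le_liminf_gaussianChannelInfo_smul {ν : Measure ℝ} [IsProbabilityMeasure ν]
    (hν : MemLp id 2 ν) (a : ι → ℝ) {u : ℕ → ℝ} (hu : Tendsto u atTop (𝓝[≠] 0)) :
    ENNReal.ofReal ((∑ i, a i ^ 2) / 2) * eVar[id; ν] ≤
      liminf (fun n => ENNReal.ofReal (1 / u n ^ 2) * gaussianChannelInfo ν (u n • a)) atTop := by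
  simp only [ofReal_inv_sq_mul_gaussianChannelInfo_eq_lintegral_prod]
  rw [← lintegral_sq_dotProduct_mul_sq_sub_mean]
  refine le_of_eq_of_le (lintegral_congr fun q => ?_) (lintegral_liminf_le fun n => by fun_prop)
  exact ((ENNReal.continuous_ofReal.tendsto _).comp
    ((tendsto_klPerspective_gaussianMixDensity_div_sq hν a q.1 q.2).comp hu)).liminf_eq.symm

lemma tendsto_gaussianChannelInfo_smul_div_sq {ν : Measure ℝ} [IsProbabilityMeasure ν]
    (hν : MemLp id 2 ν) (a : ι → ℝ) :
    Tendsto (fun ε : ℝ => ENNReal.ofReal (1 / ε ^ 2) * gaussianChannelInfo ν (ε • a)) (𝓝[≠] 0)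
      (𝓝 (ENNReal.ofReal ((∑ i, a i ^ 2) / 2) * eVar[id; ν])) := by
  refine tendsto_of_seq_tendsto fun u hu => tendsto_of_le_liminf_of_limsup_le
    (le_liminf_gaussianChannelInfo_smul hν a hu) (limsup_le_of_le (by isBoundedDefault) ?_)
  filter_upwards [hu.eventually self_mem_nhdsWithin] with n hn
  exact ofReal_inv_sq_mul_gaussianChannelInfo_smul_le ν a hn

section Conditional

variable {Ω C : Type*} [MeasurableSpace Ω] [MeasurableSpace C] {μ : Measure Ω} [IsFiniteMeasure μ]

lemma condDistrib_prodMk_of_indepFun {A B : Type*}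
    [MeasurableSpace A] [StandardBorelSpace A] [Nonempty A]
    [MeasurableSpace B] [StandardBorelSpace B] [Nonempty B] {X : Ω → A} {Z : Ω → C} {N : Ω → B}
    (hX : AEMeasurable X μ) (hZ : AEMeasurable Z μ) (hN : AEMeasurable N μ)
    (hXZN : IndepFun (fun ω => (X ω, Z ω)) N μ) :
    condDistrib (fun ω => (X ω, N ω)) Z μ =ᵐ[μ.map Z]
      condDistrib X Z μ ×ₖ Kernel.const C (μ.map N) := by
  refine condDistrib_ae_eq_of_measure_eq_compProd Z (hX.prodMk hN) ?_
  have hZXN : IndepFun (fun ω => (Z ω, X ω)) N μ :=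
    hXZN.comp (φ := Prod.swap) (ψ := id) measurable_swap measurable_id
  have hlaw := (indepFun_iff_map_prod_eq_prod_map_map (hZ.prodMk hX) hN).1 hZXN
  rw [← compProd_map_condDistrib hX] at hlaw
  refine Measure.ext_of_lintegral _ fun f hf => ?_
  have hf_assoc : Measurable fun q : (C × A) × B => f (q.1.1, (q.1.2, q.2)) := by fun_prop
  calc ∫⁻ a, f a ∂μ.map (fun ω => (Z ω, X ω, N ω))
      = ∫⁻ q, f (q.1.1, (q.1.2, q.2)) ∂μ.map (fun ω => ((Z ω, X ω), N ω)) := by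
        rw [lintegral_map' hf.aemeasurable (by fun_prop),
          lintegral_map' hf_assoc.aemeasurable (by fun_prop)]
    _ = ∫⁻ z, ∫⁻ x, ∫⁻ n, f (z, (x, n)) ∂μ.map N ∂condDistrib X Z μ z ∂μ.map Z := by
        rw [hlaw, lintegral_prod _ hf_assoc.aemeasurable,
          Measure.lintegral_compProd hf_assoc.lintegral_prod_right']
    _ = ∫⁻ a, f a ∂(μ.map Z ⊗ₘ (condDistrib X Z μ ×ₖ Kernel.const C (μ.map N))) := by
        rw [Measure.lintegral_compProd hf]
        refine lintegral_congr fun z => ?_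
        rw [Kernel.prod_apply, Kernel.const_apply, lintegral_prod _ (by fun_prop)]

lemma measurable_ofReal_sq_sub_integral_kernel (κ : Kernel C ℝ) [IsSFiniteKernel κ] :
    Measurable fun q : C × ℝ => ENNReal.ofReal ((q.2 - ∫ x, x ∂κ q.1) ^ 2) := by
  have hmean : Measurable fun z => ∫ x, x ∂κ z :=
    (StronglyMeasurable.integral_kernel_prod_right' (f := fun q : C × ℝ => q.2)
      measurable_snd.stronglyMeasurable).measurable
  exact ((measurable_snd.sub (hmean.comp measurable_fst)).pow_const 2).ennreal_ofReal

lemma measurable_evariance_kernel (κ : Kernel C ℝ) [IsSFiniteKernel κ] :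
    Measurable fun z => eVar[id; κ z] := by
  simp only [evariance_eq_lintegral_ofReal, id_eq]
  exact (measurable_ofReal_sq_sub_integral_kernel κ).lintegral_kernel_prod_right'

lemma measurable_gaussianChannelInfo_kernel (κ : Kernel C ℝ) [IsSFiniteKernel κ] (h : ι → ℝ) :
    Measurable fun z => gaussianChannelInfo (κ z) h := by
  have hmix : Measurable fun q : (C × (ι → ℝ)) × ℝ => gaussianMixDensity (κ q.1.1) h q.1.2 :=
    (measurable_gaussianMixDensity_kernel κ h).comp measurable_fst
  have hinner := Measurable.lintegral_kernel_prod_right' (κ := κ.prodMkRight (ι → ℝ))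
    (f := fun q => ENNReal.ofReal
      (klPerspective (gaussianShiftDensity (q.2 • h) q.1.2) (gaussianMixDensity (κ q.1.1) h q.1.2)))
    (by fun_prop)
  exact hinner.lintegral_prod_right'

variable {X : Ω → ℝ} {Z : Ω → C}

lemma lintegral_evariance_condDistrib (hX : Integrable X μ)
    (hXZ : MemLp (X - μ[X | MeasurableSpace.comap Z inferInstance]) 2 μ) (hZ : Measurable Z) :
    ∫⁻ z, eVar[id; condDistrib X Z μ z] ∂μ.map Z = ENNReal.ofReal (avgCondVar μ X Z) := by
  have hsq := measurable_ofReal_sq_sub_integral_kernel (condDistrib X Z μ)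
  simp only [evariance_eq_lintegral_ofReal, id_eq, avgCondVar, condVar]
  rw [← Measure.lintegral_compProd hsq, compProd_map_condDistrib hX.aemeasurable,
    lintegral_map' hsq.aemeasurable (hZ.aemeasurable.prodMk hX.aemeasurable),
    integral_condExp hZ.comap_le]
  simp only [Pi.pow_apply]
  rw [ofReal_integral_eq_lintegral_ofReal hXZ.integrable_sq (ae_of_all _ fun _ => sq_nonneg _)]
  refine lintegral_congr_ae ?_
  filter_upwards [condExp_ae_eq_integral_condDistrib' hZ hX] with ω hω
  simp [hω]

lemma ae_memLp_id_condDistrib (hX : Integrable X μ)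
    (hXZ : MemLp (X - μ[X | MeasurableSpace.comap Z inferInstance]) 2 μ) (hZ : Measurable Z) :
    ∀ᵐ z ∂μ.map Z, MemLp id 2 (condDistrib X Z μ z) := by
  have hfin : ∫⁻ z, eVar[id; condDistrib X Z μ z] ∂μ.map Z ≠ ∞ :=
    lintegral_evariance_condDistrib hX hXZ hZ ▸ ENNReal.ofReal_ne_top
  filter_upwards [ae_lt_top (measurable_evariance_kernel _) hfin] with z hz
  exact (evariance_lt_top_iff_memLp aestronglyMeasurable_id).1 hz

lemma condMutualInfo_gaussianChannel {N : Ω → ι → ℝ} (hX : AEMeasurable X μ)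
    (hZ : AEMeasurable Z μ) (hN : HasLaw N (stdGaussianPi ι) μ)
    (hXZN : IndepFun (fun ω => (X ω, Z ω)) N μ) (h : ι → ℝ) :
    condMutualInfo μ X (fun ω => X ω • h + N ω) Z =
      (∫⁻ z, gaussianChannelInfo (condDistrib X Z μ z) h ∂μ.map Z) /
        ENNReal.ofReal (Real.log 2) := by
  have hXN : AEMeasurable (fun ω => (X ω, N ω)) μ := hX.prodMk hN.aemeasurable
  have hjoint : Measurable fun q : ℝ × (ι → ℝ) => (q.1, q.1 • h + q.2) := by fun_prop
  have hindep := condDistrib_prodMk_of_indepFun hX hZ hN.aemeasurable hXZN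
  rw [hN.map_eq] at hindep
  rw [condMutualInfo]
  congr 1
  refine lintegral_congr_ae ?_
  filter_upwards [hindep, condDistrib_comp Z hXN hjoint, condDistrib_comp Z hXN hjoint.snd]
    with z hz hz_joint hz_output
  rw [Kernel.map_apply _ hjoint, hz, Kernel.prod_apply, Kernel.const_apply] at hz_joint
  rw [Kernel.map_apply _ hjoint.snd, hz, Kernel.prod_apply, Kernel.const_apply] at hz_output
  rw [← klDiv_gaussianChannel, ← hz_joint, ← hz_output]
  rfl

lemma tendsto_lintegral_gaussianChannelInfo_smul_div_sq (hX : Integrable X μ)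
    (hXZ : MemLp (X - μ[X | MeasurableSpace.comap Z inferInstance]) 2 μ) (hZ : Measurable Z)
    (a : ι → ℝ) :
    Tendsto (fun ε : ℝ => ENNReal.ofReal (1 / ε ^ 2) *
        ∫⁻ z, gaussianChannelInfo (condDistrib X Z μ z) (ε • a) ∂μ.map Z) (𝓝[≠] 0)
      (𝓝 (ENNReal.ofReal ((∑ i, a i ^ 2) / 2) * ENNReal.ofReal (avgCondVar μ X Z))) := by
  have hmeas := measurable_gaussianChannelInfo_kernel (ι := ι) (condDistrib X Z μ)
  have hvar := measurable_evariance_kernel (condDistrib X Z μ)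
  simp only [← lintegral_evariance_condDistrib hX hXZ hZ, ← lintegral_const_mul _ hvar,
    ← lintegral_const_mul _ (hmeas _)]
  refine tendsto_lintegral_filter_of_dominated_convergence
    (fun z => ENNReal.ofReal ((∑ i, a i ^ 2) / 2) * eVar[id; condDistrib X Z μ z])
    (Eventually.of_forall fun ε => (hmeas _).const_mul _) ?_ ?_ ?_
  · filter_upwards [self_mem_nhdsWithin] with ε hε
    exact ae_of_all _ fun z => ofReal_inv_sq_mul_gaussianChannelInfo_smul_le _ a hε
  · rw [lintegral_const_mul _ hvar, lintegral_evariance_condDistrib hX hXZ hZ]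
    exact ENNReal.mul_ne_top ENNReal.ofReal_ne_top ENNReal.ofReal_ne_top
  · filter_upwards [ae_memLp_id_condDistrib hX hXZ hZ] with z hz
    exact tendsto_gaussianChannelInfo_smul_div_sq hz a

end Conditional

end GaussianChannel

theorem mainTheorem5_general {ι Ω C : Type*} [Fintype ι] [MeasurableSpace Ω] [MeasurableSpace C]
    (μ : Measure Ω) [IsFiniteMeasure μ] {X : Ω → ℝ} {Z : Ω → C} {N : Ω → ι → ℝ}
    (hX : Integrable X μ)
    (hXZ : MemLp (X - μ[X | MeasurableSpace.comap Z inferInstance]) 2 μ) (hZ : Measurable Z)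
    (hN : HasLaw N (stdGaussianPi ι) μ) (hXZN : IndepFun (fun ω => (X ω, Z ω)) N μ) (a : ι → ℝ) :
    Tendsto
      (fun γ : ℝ => ENNReal.ofReal (1 / γ) *
        condMutualInfo μ X (fun ω i => a i * (Real.sqrt γ * X ω) + N ω i) Z)
      (𝓝[>] 0)
      (𝓝 (ENNReal.ofReal
        ((∑ i, a i ^ 2) * Real.logb 2 (Real.exp 1) / 2 * avgCondVar μ X Z))) := by
  have hlog : 0 < Real.log 2 := Real.log_pos one_lt_two
  have hsqrt : Tendsto Real.sqrt (𝓝[>] 0) (𝓝[≠] 0) :=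
    tendsto_nhdsWithin_iff.2
      ⟨(Real.continuous_sqrt.tendsto' 0 0 Real.sqrt_zero).mono_left nhdsWithin_le_nhds,
        eventually_mem_nhdsWithin.mono fun _ hγ => (Real.sqrt_pos.2 hγ).ne'⟩
  have hbits := ENNReal.Tendsto.div_const
    ((tendsto_lintegral_gaussianChannelInfo_smul_div_sq hX hXZ hZ a).comp hsqrt)
    (b := ENNReal.ofReal (Real.log 2)) (Or.inr (ENNReal.ofReal_pos.2 hlog).ne')
  convert hbits.congr' ?_ using 2
  · rw [← ENNReal.ofReal_mul (by positivity), ← ENNReal.ofReal_div_of_pos hlog, Real.logb,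
      Real.log_exp]
    congr 1
    ring
  · filter_upwards [self_mem_nhdsWithin] with γ hγ
    have hchannel : (fun ω i => a i * (Real.sqrt γ * X ω) + N ω i) =
        fun ω => X ω • Real.sqrt γ • a + N ω := by
      ext ω i
      simp only [Pi.add_apply, Pi.smul_apply, smul_eq_mul]
      ring
    rw [hchannel, condMutualInfo_gaussianChannel hX.aemeasurable hZ.aemeasurable hN hXZN,
      Function.comp_apply, Real.sq_sqrt (le_of_lt hγ), mul_div_assoc]

theorem mainTheorem5 {Ω C : Type*} [MeasurableSpace Ω] [MeasurableSpace C]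
    (μ : Measure Ω) [IsProbabilityMeasure μ] (K : ℕ)
    (X : Ω → ℝ) (Z : Ω → C) (N : Fin K → Ω → ℝ)
    (hX : Measurable X) (hX2 : MemLp X 2 μ) (hZ : Measurable Z) (hN : ∀ i, Measurable (N i))
    (hN_law : ∀ i, HasLaw (N i) (gaussianReal 0 1) μ)
    (hN_indep : iIndepFun N μ)
    (hXZN : IndepFun (fun ω => (X ω, Z ω)) (fun ω i => N i ω) μ) :
    Tendsto
      (fun γ : ℝ => ENNReal.ofReal (1 / γ) *
        condMutualInfo μ X (fun ω (i : Fin K) => Real.sqrt γ * X ω + N i ω) Z)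
      (𝓝[>] 0)
      (𝓝 (ENNReal.ofReal (K * Real.logb 2 (Real.exp 1) / 2 * avgCondVar μ X Z))) := by
  simpa using mainTheorem5_general μ (hX2.integrable one_le_two)
    (hX2.sub (hX2.condExp one_le_two)) hZ (iIndepFun.hasLaw_pi hN_law hN_indep) hXZN fun _ => 1
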